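/- Let $a \in \mathbb{R}$ be such that $(1 + a^2/2)^{1/2}$ is not an integer, and let $f \colon \mathbb{R} \to \mathbb{R}$ be a real analytic $2\pi$-periodic function. Then there is $\mu_0 > 0$ (depending on $a$ and $f$) such that for every $\mu \in (0, \mu_0)$ the averaged pendulum system with friction coefficient $\mu$ and horizontal force $F(t) = \mu f(t)$, $$ \dot\varphi = p, \qquad \dot p = -\sin\varphi - \mu p - \frac{a^2}{4}\sin 2\varphi + \mu f(t)\cos\varphi, $$ has a $2\pi$-periodic solution $(\varphi(t), p(t))$ that is asymptotically stable in the sense of Lyapunov. -/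

import Mathlib

open Set Filter Topology

/-- The right-hand side of the averaged equations of the pendulum with vertically vibrating pivot,
viscous friction `μ` and horizontal force `F`, in the phase variables `(φ, p)`:
`φ' = p`, `p' = - sin φ - μ p - (a² / 4) sin (2 φ) + F(t) cos φ`.
The slow time `s`, with `s' = 1`, is the time `t`. -/
noncomputable def averagedPendulum (a μ : ℝ) (F : ℝ → ℝ) (t : ℝ) (x : ℝ × ℝ) : ℝ × ℝ :=
  (x.2,
    -Real.sin x.1 - μ * x.2 - (a ^ 2 / 4) * Real.sin (2 * x.1) + F t * Real.cos x.1)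

/-- Asymptotic stability in the sense of Lyapunov of a solution `x` of `y' = v t y`.
`stable` is asked of solutions on every compact interval `[t₀, T]`, so it does not presuppose that
the neighbouring solutions exist for all later times; in finite dimension it forces them to, by
continuation of bounded solutions. -/
structure IsAsymptoticallyStable {E : Type*} [NormedAddCommGroup E] [NormedSpace ℝ E]
    (v : ℝ → E → E) (x : ℝ → E) : Prop where
  stable : ∀ t₀ : ℝ, ∀ ε > 0, ∃ δ > 0, ∀ (T : ℝ) (y : ℝ → E),
    IsIntegralCurveOn y v (Icc t₀ T) → ‖y t₀ - x t₀‖ < δ → ∀ t ∈ Icc t₀ T, ‖y t - x t‖ < ε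
  attractive : ∀ t₀ : ℝ, ∃ η > 0, ∀ y : ℝ → E,
    IsIntegralCurveOn y v (Ici t₀) → ‖y t₀ - x t₀‖ < η →
      Tendsto (fun t => ‖y t - x t‖) atTop (𝓝 0)

/-! With `ω² = 1 + a²/2`, the linearization at `φ = 0` is the oscillator `φ'' + ω² φ = 0`, perturbed
by friction and forcing of order `μ`. As `ω` is not an integer, the oscillator has no resonance with
period `2π`, so a contraction argument (`exists_periodic_solution`) gives a periodic solution with
`φ = O(μ)`. Since the nonlinearity is cubic and the forcing enters through `μ f cos φ`, replacing
the equilibrium by this solution changes the linearized force only by `O(μ²)`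
(`abs_pendulumRemainder_sub_le`). Friction contracts at rate of order `μ` and wins for small `μ`: a
quadratic Lyapunov function of the difference of two solutions decays exponentially
(`oscillatorLyapunov_le_exp`). -/

/-! ### Periodic solutions of a weakly perturbed nonresonant oscillator. -/

/-- The `T`-periodic solution of `z' = i ω z + h` for a `T`-periodic forcing `h`,
provided that `exp (-i ω T) ≠ 1`. -/
noncomputable def periodicResponse (ω T : ℝ) (h : ℝ → ℂ) (t : ℝ) : ℂ :=
  (Complex.exp (-(Complex.I * ω * T)) - 1)⁻¹ * (Complex.exp (Complex.I * ω * t) *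
    ∫ s in t..t + T, Complex.exp (-(Complex.I * ω * s)) * h s)

theorem continuous_exp_mul {ω : ℝ} {h : ℝ → ℂ} (hc : Continuous h) :
    Continuous fun s : ℝ => Complex.exp (-(Complex.I * ω * s)) * h s := by fun_prop

theorem hasDerivAt_periodicResponse {ω T : ℝ} {h : ℝ → ℂ} (hc : Continuous h)
    (hp : Function.Periodic h T) (hω : Complex.exp (-(Complex.I * ω * T)) ≠ 1) (t : ℝ) :
    HasDerivAt (periodicResponse ω T h)
      (Complex.I * ω * periodicResponse ω T h t + h t) t := by
  set k : ℝ → ℂ := fun s => Complex.exp (-(Complex.I * ω * s)) * h s with hk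
  have hkc : Continuous k := continuous_exp_mul hc
  have h0 (s : ℝ) : HasDerivAt (fun u => ∫ x in (0 : ℝ)..u, k x) (k s) s :=
    intervalIntegral.integral_hasDerivAt_right (hkc.intervalIntegrable _ _)
      (hkc.stronglyMeasurableAtFilter _ _) hkc.continuousAt
  have h1 : HasDerivAt (fun u => ∫ x in u..u + T, k x) (k (t + T) - k t) t := by
    have h2 := ((h0 (t + T)).comp_add_const t T).sub (h0 t)
    refine h2.congr_of_eventuallyEq (Eventually.of_forall fun u => ?_)
    exact (intervalIntegral.integral_interval_sub_left (hkc.intervalIntegrable _ _)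
      (hkc.intervalIntegrable _ _)).symm
  have he : HasDerivAt (fun u : ℝ => Complex.exp (Complex.I * ω * u))
      (Complex.exp (Complex.I * ω * t) * (Complex.I * ω)) t := by
    have := ((hasDerivAt_id (t : ℂ)).const_mul (Complex.I * ω)).cexp.comp_ofReal
    simpa using this
  have h3 := (he.mul h1).const_mul (Complex.exp (-(Complex.I * ω * T)) - 1)⁻¹
  refine h3.congr_deriv ?_
  have hne : Complex.exp (-(Complex.I * ω * T)) - 1 ≠ 0 := sub_ne_zero.2 hω
  have e1 : k (t + T) - k t = (Complex.exp (-(Complex.I * ω * T)) - 1) *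
      (Complex.exp (-(Complex.I * ω * t)) * h t) := by
    simp only [hk, hp t]
    rw [show -(Complex.I * ω * ((t + T : ℝ) : ℂ)) =
      -(Complex.I * ω * T) + -(Complex.I * ω * t) by push_cast; ring, Complex.exp_add]
    ring
  have e2 : Complex.exp (Complex.I * ω * t) * Complex.exp (-(Complex.I * ω * t)) = 1 := by
    rw [← Complex.exp_add, add_neg_cancel, Complex.exp_zero]
  rw [e1, periodicResponse]
  field_simp
  linear_combination (h t * (Complex.exp (-(Complex.I * ω * T)) - 1)) * e2

theorem periodic_periodicResponse {ω T : ℝ} {h : ℝ → ℂ} (hp : Function.Periodic h T) :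
    Function.Periodic (periodicResponse ω T h) T := by
  intro t
  unfold periodicResponse
  congr 1
  rw [← intervalIntegral.integral_comp_add_right (a := t) (b := t + T) _ T,
    ← intervalIntegral.integral_const_mul, ← intervalIntegral.integral_const_mul]
  refine intervalIntegral.integral_congr fun s _ => ?_
  simp only [hp s, ← mul_assoc, ← Complex.exp_add]
  congr 2
  push_cast
  ring

theorem norm_exp_I_mul_ofReal_mul (ω t : ℝ) : ‖Complex.exp (Complex.I * ω * t)‖ = 1 := by
  rw [show Complex.I * ω * t = ((ω * t : ℝ) : ℂ) * Complex.I by push_cast; ring]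
  exact Complex.norm_exp_ofReal_mul_I _

theorem norm_periodicResponse_le {ω T B : ℝ} {h : ℝ → ℂ} (hT : 0 ≤ T) (hB : ∀ t, ‖h t‖ ≤ B)
    (t : ℝ) : ‖periodicResponse ω T h t‖ ≤
      T / ‖Complex.exp (-(Complex.I * ω * T)) - 1‖ * B := by
  have h1 : ‖∫ s in t..t + T, Complex.exp (-(Complex.I * ω * s)) * h s‖ ≤ B * |t + T - t| := by
    refine intervalIntegral.norm_integral_le_of_norm_le_const fun s _ => ?_
    have := norm_exp_I_mul_ofReal_mul ω (-s)
    rw [Complex.ofReal_neg, mul_neg] at this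
    rw [norm_mul, this, one_mul]
    exact hB s
  rw [add_sub_cancel_left, abs_of_nonneg hT] at h1
  rw [periodicResponse, norm_mul, norm_mul, norm_exp_I_mul_ofReal_mul, one_mul, norm_inv,
    div_mul_eq_mul_div, div_eq_inv_mul, mul_comm T]
  gcongr

theorem periodicResponse_sub {ω T : ℝ} {h k : ℝ → ℂ} (hc : Continuous h) (kc : Continuous k)
    (t : ℝ) : periodicResponse ω T h t - periodicResponse ω T k t =
      periodicResponse ω T (fun s => h s - k s) t := by
  simp only [periodicResponse, mul_sub]
  rw [intervalIntegral.integral_sub ((continuous_exp_mul hc).intervalIntegrable _ _)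
    ((continuous_exp_mul kc).intervalIntegrable _ _)]
  ring

/-- A weakly nonlinear periodic perturbation of the nonresonant oscillator `z' = i ω z` has a
small periodic solution. -/
theorem exists_periodic_solution {ω T r L B : ℝ} (hT : 0 < T)
    (hω : Complex.exp (-(Complex.I * ω * T)) ≠ 1) {H : ℝ → ℂ → ℂ}
    (hc : Continuous fun q : ℝ × ℂ => H q.1 q.2) (hp : ∀ t z, H (t + T) z = H t z)
    (hr : 0 ≤ r) (hL0 : 0 ≤ L)
    (hL : ∀ t z w, ‖z‖ ≤ r → ‖w‖ ≤ r → ‖H t z - H t w‖ ≤ L * ‖z - w‖)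
    (hB : ∀ t, ‖H t 0‖ ≤ B)
    (hCL : T / ‖Complex.exp (-(Complex.I * ω * T)) - 1‖ * L ≤ 1 / 2)
    (hCB : T / ‖Complex.exp (-(Complex.I * ω * T)) - 1‖ * B ≤ r / 2) :
    ∃ z : ℝ → ℂ, (∀ t, HasDerivAt z (Complex.I * ω * z t + H t (z t)) t) ∧
      Function.Periodic z T ∧ ∀ t, ‖z t‖ ≤ r := by
  set C := T / ‖Complex.exp (-(Complex.I * ω * T)) - 1‖ with hCdef
  have hC : 0 ≤ C := by positivity
  -- Fixed points of `z ↦ periodicResponse ω T (H · (z ·))` on this closed set are the solutions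
  -- sought.
  let S : Set (BoundedContinuousFunction ℝ ℂ) :=
    {z | (∀ t, z (t + T) = z t) ∧ ∀ t, ‖z t‖ ≤ r}
  have hS : IsClosed S := by
    have hev (t : ℝ) : Continuous fun z : BoundedContinuousFunction ℝ ℂ => z t :=
      (BoundedContinuousFunction.lipschitz_eval_const t).continuous
    simp only [S, ofPred_and, ofPred_forall]
    exact (isClosed_iInter fun t => isClosed_eq (hev _) (hev _)).inter
      (isClosed_iInter fun t => isClosed_le (hev t).norm continuous_const)
  have : CompleteSpace S := hS.completeSpace_coe
  have hHc (z : BoundedContinuousFunction ℝ ℂ) : Continuous fun t => H t (z t) :=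
    hc.comp (continuous_id.prodMk z.continuous)
  have hHp (z : S) : Function.Periodic (fun t => H t (z.1 t)) T := fun t => by
    simp only [hp, z.2.1 t]
  have hderiv (z : S) := hasDerivAt_periodicResponse (hHc z.1) (hHp z) hω
  have hbound (z : S) (t : ℝ) : ‖periodicResponse ω T (fun t => H t (z.1 t)) t‖ ≤ r := by
    -- The ball is preserved because `C * B ≤ r / 2` and `C * L * r ≤ r / 2`.
    refine (norm_periodicResponse_le (B := B + L * r) hT.le (fun t => ?_) t).trans ?_
    · have h1 := hL t (z.1 t) 0 (z.2.2 t) (by simpa using hr)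
      have h2 := norm_le_norm_add_norm_sub' (H t (z.1 t)) (H t 0)
      have h3 := hB t
      have h4 : L * ‖z.1 t - 0‖ ≤ L * r := by
        rw [sub_zero]; exact mul_le_mul_of_nonneg_left (z.2.2 t) hL0
      linarith
    · rw [← hCdef]
      nlinarith
  let Φ : S → S := fun z =>
    ⟨BoundedContinuousFunction.ofNormedAddCommGroup
      (periodicResponse ω T fun t => H t (z.1 t))
      (continuous_iff_continuousAt.2 fun t => (hderiv z t).continuousAt) r (hbound z),
      periodic_periodicResponse (hHp z), hbound z⟩
  have hΦ : ContractingWith (1 / 2) Φ := by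
    refine ⟨by norm_num [← NNReal.coe_lt_coe], LipschitzWith.of_dist_le_mul fun z w => ?_⟩
    rw [Subtype.dist_eq, Subtype.dist_eq]
    refine (BoundedContinuousFunction.dist_le (by positivity)).2 fun t => ?_
    change dist (periodicResponse ω T (fun t => H t (z.1 t)) t)
      (periodicResponse ω T (fun t => H t (w.1 t)) t) ≤ _
    rw [dist_eq_norm, periodicResponse_sub (hHc _) (hHc _)]
    refine (norm_periodicResponse_le (B := L * dist z.1 w.1) hT.le (fun s => ?_) t).trans ?_
    · refine (hL s _ _ (z.2.2 s) (w.2.2 s)).trans ?_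
      rw [← dist_eq_norm]
      exact mul_le_mul_of_nonneg_left (BoundedContinuousFunction.dist_coe_le_dist s) hL0
    · rw [← hCdef, ← mul_assoc]
      refine mul_le_mul_of_nonneg_right ?_ dist_nonneg
      simpa using hCL
  have : Nonempty S := ⟨⟨0, by simp [S, hr]⟩⟩
  set z := ContractingWith.fixedPoint Φ hΦ
  have hz : periodicResponse ω T (fun t => H t (z.1 t)) = z.1 := by
    have := hΦ.fixedPoint_isFixedPt
    exact congrArg (fun w : S => (w.1 : ℝ → ℂ)) this
  refine ⟨z.1, fun t => ?_, z.2.1, z.2.2⟩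
  have := hderiv z t
  rwa [hz] at this

/-! ### The nonlinear remainder. -/

/-- The force of the averaged pendulum without its linear part and without friction. -/
noncomputable def pendulumRemainder (a μ : ℝ) (f : ℝ → ℝ) (t x : ℝ) : ℝ :=
  (1 + a ^ 2 / 2) * x - Real.sin x - a ^ 2 / 4 * Real.sin (2 * x) + μ * f t * Real.cos x

theorem averagedPendulum_eq (a μ : ℝ) (f : ℝ → ℝ) (t : ℝ) (x : ℝ × ℝ) :
    averagedPendulum a μ (fun t => μ * f t) t x =
      (x.2, -(1 + a ^ 2 / 2) * x.1 - μ * x.2 + pendulumRemainder a μ f t x.1) := by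
  simp only [averagedPendulum, pendulumRemainder, Prod.mk.injEq, true_and]
  ring

/-- Mean value inequality. The linear terms cancel, so the unforced part of the derivative is
quadratic in the position by `1 - cos s ≤ s²/2`; the forcing contributes `μ f sin`, which is at most
`μ M r`. -/
theorem abs_pendulumRemainder_sub_le {a μ M r t : ℝ} {f : ℝ → ℝ} (hμ : 0 ≤ μ) (hM : |f t| ≤ M)
    {x y : ℝ} (hx : |x| ≤ r) (hy : |y| ≤ r) :
    |pendulumRemainder a μ f t x - pendulumRemainder a μ f t y| ≤
      ((1 + a ^ 2) * r ^ 2 + μ * M * r) * |x - y| := by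
  have hd (s : ℝ) : HasDerivAt (pendulumRemainder a μ f t)
      ((1 - Real.cos s) + a ^ 2 / 2 * (1 - Real.cos (2 * s)) - μ * f t * Real.sin s) s := by
    have h1 := ((((hasDerivAt_id s).const_mul (1 + a ^ 2 / 2)).sub (Real.hasDerivAt_sin s)).sub
      ((((hasDerivAt_id s).const_mul 2).sin).const_mul (a ^ 2 / 4))).add
      ((Real.hasDerivAt_cos s).const_mul (μ * f t))
    refine h1.congr_deriv ?_
    simp only [id]
    ring
  have hb (s : ℝ) (hs : s ∈ Icc (-r) r) :
      ‖(1 - Real.cos s) + a ^ 2 / 2 * (1 - Real.cos (2 * s)) - μ * f t * Real.sin s‖ ≤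
        (1 + a ^ 2) * r ^ 2 + μ * M * r := by
    have hs' : |s| ≤ r := abs_le.2 hs
    have hr : 0 ≤ r := (abs_nonneg s).trans hs'
    have hsq : s ^ 2 ≤ r ^ 2 := sq_le_sq' hs.1 hs.2
    have c1 := Real.one_sub_sq_div_two_le_cos (x := s)
    have c2 := Real.one_sub_sq_div_two_le_cos (x := 2 * s)
    have c3 := Real.cos_le_one s
    have c4 := Real.cos_le_one (2 * s)
    have h1 : a ^ 2 / 2 * (1 - Real.cos (2 * s)) ≤ a ^ 2 / 2 * (2 * r ^ 2) :=
      mul_le_mul_of_nonneg_left (by linarith) (by positivity)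
    have h2 : 0 ≤ a ^ 2 / 2 * (1 - Real.cos (2 * s)) :=
      mul_nonneg (by positivity) (by linarith)
    have h3 : |μ * f t * Real.sin s| ≤ μ * M * r := by
      rw [abs_mul, abs_mul, abs_of_nonneg hμ]
      exact mul_le_mul (mul_le_mul_of_nonneg_left hM hμ) (Real.abs_sin_le_abs.trans hs')
        (abs_nonneg _) (mul_nonneg hμ ((abs_nonneg _).trans hM))
    rw [Real.norm_eq_abs]
    refine (abs_sub _ _).trans (add_le_add ?_ h3)
    rw [abs_of_nonneg (by linarith)]
    nlinarith
  exact (convex_Icc (-r) r).norm_image_sub_le_of_norm_hasDerivWithin_le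
    (fun s _ => (hd s).hasDerivWithinAt) hb (abs_le.1 hy) (abs_le.1 hx)

/-! ### Exponential decay of the Lyapunov function. -/

/-- A Lyapunov function of the damped oscillator `u'' + μ u' + k u = 0`. -/
def oscillatorLyapunov (k μ u v : ℝ) : ℝ := k * u ^ 2 + v ^ 2 + μ * u * v

theorem sq_add_sq_le_oscillatorLyapunov {k μ : ℝ} (hk : 1 ≤ k) (hμ0 : 0 ≤ μ) (hμ1 : μ ≤ 1)
    (u v : ℝ) : (u ^ 2 + v ^ 2) / 2 ≤ oscillatorLyapunov k μ u v := by
  unfold oscillatorLyapunov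
  nlinarith [mul_nonneg hμ0 (sq_nonneg (u + v)), mul_nonneg (sub_nonneg.2 hk) (sq_nonneg u),
    mul_nonneg (sub_nonneg.2 hμ1) (add_nonneg (sq_nonneg u) (sq_nonneg v))]

theorem oscillatorLyapunov_lt {k μ d u v : ℝ} (hk : 1 ≤ k) (hμ0 : 0 ≤ μ) (hμ1 : μ ≤ 1)
    (hu : |u| < d) (hv : |v| < d) : oscillatorLyapunov k μ u v < (k + 2) * d ^ 2 := by
  have h1 : u ^ 2 < d ^ 2 := sq_lt_sq' (abs_lt.1 hu).1 (abs_lt.1 hu).2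
  have h2 : v ^ 2 < d ^ 2 := sq_lt_sq' (abs_lt.1 hv).1 (abs_lt.1 hv).2
  unfold oscillatorLyapunov
  nlinarith [mul_nonneg hμ0 (sq_nonneg (u - v)),
    mul_nonneg (sub_nonneg.2 hμ1) (add_nonneg (sq_nonneg u) (sq_nonneg v))]

/-- The cross term `μ u v` makes the derivative of `V` along the linear flow exactly `-μ V`. The
perturbation costs at most `μ/4 (u² + v²) ≤ μ/2 V`. -/
theorem oscillatorLyapunov_deriv_lt {k μ u v ρ : ℝ} (hk : 1 ≤ k) (hμ0 : 0 < μ) (hμ1 : μ ≤ 1)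
    (hρ : |ρ| ≤ μ / 8 * |u|) (hV : 0 < oscillatorLyapunov k μ u v) :
    k * (2 * u * v) + 2 * v * (-k * u - μ * v + ρ) +
      μ * (v * v + u * (-k * u - μ * v + ρ)) < -(μ / 4) * oscillatorLyapunov k μ u v := by
  have h1 : (2 * v + μ * u) * ρ ≤ μ / 4 * (u ^ 2 + v ^ 2) := by
    have h2 : |2 * v + μ * u| ≤ 2 * |v| + |u| := by
      refine (abs_add_le _ _).trans ?_
      rw [abs_mul, abs_mul, abs_two, abs_of_pos hμ0]
      nlinarith [abs_nonneg u]
    have h3 : (2 * v + μ * u) * ρ ≤ (2 * |v| + |u|) * (μ / 8 * |u|) := by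
      refine (le_abs_self _).trans ?_
      rw [abs_mul]
      exact mul_le_mul h2 hρ (abs_nonneg _) (by positivity)
    have h4 : (2 * |v| + |u|) * |u| ≤ 2 * (u ^ 2 + v ^ 2) := by
      rw [← sq_abs u, ← sq_abs v]
      nlinarith [sq_nonneg (|u| - |v|), sq_nonneg |v|]
    nlinarith
  have h5 := sq_add_sq_le_oscillatorLyapunov hk hμ0.le hμ1 u v
  have h6 : k * (2 * u * v) + 2 * v * (-k * u - μ * v + ρ) +
      μ * (v * v + u * (-k * u - μ * v + ρ)) =
      -μ * oscillatorLyapunov k μ u v + (2 * v + μ * u) * ρ := by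
    unfold oscillatorLyapunov; ring
  nlinarith [mul_pos hμ0 hV]

/-- The exponential is a barrier, so the differential inequality is needed only where `V` touches
it. There `V ≤ η ≤ μ²/2` gives `|u| ≤ μ`, which makes the bound on `ρ` available without a separate
continuation argument. -/
theorem oscillatorLyapunov_le_exp {k μ η t₀ T : ℝ} {u v ρ : ℝ → ℝ} (hk : 1 ≤ k) (hμ0 : 0 < μ)
    (hμ1 : μ ≤ 1) (hu : ∀ t ∈ Icc t₀ T, HasDerivWithinAt u (v t) (Icc t₀ T) t)
    (hv : ∀ t ∈ Icc t₀ T, HasDerivWithinAt v (-k * u t - μ * v t + ρ t) (Icc t₀ T) t)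
    (hρ : ∀ t ∈ Icc t₀ T, |u t| ≤ μ → |ρ t| ≤ μ / 8 * |u t|) (hη0 : 0 < η)
    (hη : η ≤ μ ^ 2 / 2) (h0 : oscillatorLyapunov k μ (u t₀) (v t₀) ≤ η) :
    ∀ t ∈ Icc t₀ T, oscillatorLyapunov k μ (u t) (v t) ≤ η * Real.exp (-(μ / 4) * (t - t₀)) := by
  have hd (t : ℝ) (ht : t ∈ Icc t₀ T) :
      HasDerivWithinAt (fun t => oscillatorLyapunov k μ (u t) (v t))
        (k * (2 * u t * v t) + 2 * v t * (-k * u t - μ * v t + ρ t) +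
          μ * (v t * v t + u t * (-k * u t - μ * v t + ρ t))) (Icc t₀ T) t := by
    have h1 := ((((hu t ht).pow 2).const_mul k).add ((hv t ht).pow 2)).add
      (((hu t ht).const_mul μ).mul (hv t ht))
    refine h1.congr_deriv ?_
    push_cast
    ring
  refine image_le_of_deriv_right_lt_deriv_boundary
    (B' := fun t => -(μ / 4) * (η * Real.exp (-(μ / 4) * (t - t₀))))
    (fun t ht => (hd t ht).continuousWithinAt)
    (fun t ht => (hd t ⟨ht.1, ht.2.le⟩).mono_of_mem_nhdsWithin
      (Icc_mem_nhdsGE_of_mem ht)) (by simpa using h0) (fun t => ?_) fun t ht hV => ?_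
  · refine ((((hasDerivAt_id t).sub_const t₀).const_mul (-(μ / 4))).exp.const_mul η).congr_deriv ?_
    simp only [id]
    ring
  · have hpos : 0 < oscillatorLyapunov k μ (u t) (v t) := by rw [hV]; positivity
    have hle : oscillatorLyapunov k μ (u t) (v t) ≤ η := by
      rw [hV]
      refine mul_le_of_le_one_right hη0.le (Real.exp_le_one_iff.2 ?_)
      nlinarith [ht.1]
    have hut : |u t| ≤ μ := by
      refine abs_le_of_sq_le_sq ?_ hμ0.le
      linarith [sq_add_sq_le_oscillatorLyapunov hk hμ0.le hμ1 (u t) (v t), sq_nonneg (v t)]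
    rw [← hV]
    exact oscillatorLyapunov_deriv_lt hk hμ0 hμ1 (hρ t ⟨ht.1, ht.2.le⟩ hut) hpos

/-! ### The small periodic solution of the pendulum. -/

theorem continuous_pendulumRemainder {a μ : ℝ} {f : ℝ → ℝ} (hf : Continuous f) :
    Continuous fun q : ℝ × ℝ => pendulumRemainder a μ f q.1 q.2 := by
  unfold pendulumRemainder
  fun_prop

theorem one_le_sqrt_one_add_sq_div_two (a : ℝ) : 1 ≤ Real.sqrt (1 + a ^ 2 / 2) :=
  Real.one_le_sqrt.2 (by linarith [sq_nonneg a])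

theorem cexp_neg_two_pi_mul_ne_one {ω : ℝ} (hω : ∀ n : ℤ, ω ≠ n) :
    Complex.exp (-(Complex.I * ω * (2 * Real.pi : ℝ))) ≠ 1 := by
  intro h
  obtain ⟨n, hn⟩ := Complex.exp_eq_one_iff.1 h
  refine hω (-n) ?_
  have hpi : (2 * Real.pi * Complex.I : ℂ) ≠ 0 := Complex.two_pi_I_ne_zero
  have h1 : (ω : ℂ) = -n := by
    apply mul_right_cancel₀ hpi
    push_cast at hn
    linear_combination -hn
  exact_mod_cast h1

theorem exists_small_periodic_solution {a : ℝ}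
    (ha : ∀ n : ℤ, Real.sqrt (1 + a ^ 2 / 2) ≠ (n : ℝ)) {f : ℝ → ℝ} (hf : Continuous f)
    (hper : Function.Periodic f (2 * Real.pi)) {M : ℝ} (hM : ∀ t, |f t| ≤ M) :
    ∃ N μ₁ : ℝ, 0 ≤ N ∧ 0 < μ₁ ∧ ∀ μ : ℝ, 0 < μ → μ < μ₁ →
      ∃ x : ℝ → ℝ × ℝ, IsIntegralCurve x (averagedPendulum a μ (fun t => μ * f t)) ∧
        Function.Periodic x (2 * Real.pi) ∧ ∀ t, |(x t).1| ≤ N * μ := by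
  set ω := Real.sqrt (1 + a ^ 2 / 2) with hωdef
  have hω1 : 1 ≤ ω := one_le_sqrt_one_add_sq_div_two a
  have hω0 : 0 < ω := by linarith
  have hωsq : ω ^ 2 = 1 + a ^ 2 / 2 := Real.sq_sqrt (by positivity)
  have hM0 : 0 ≤ M := (abs_nonneg _).trans (hM 0)
  set C := 2 * Real.pi / ‖Complex.exp (-(Complex.I * ω * (2 * Real.pi : ℝ))) - 1‖ with hC
  have hC0 : 0 ≤ C := by positivity
  -- Chosen so that forcing `B = μ M` and radius `r = N μ` satisfy `C * B = r / 2`.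
  set N := 2 * C * M with hN
  have hN0 : 0 ≤ N := by positivity
  -- `A μ` is a Lipschitz constant on the ball of radius `N μ` when `μ ≤ 1`; the `+ 1` accounts for
  -- friction.
  set A := (1 + a ^ 2) * N ^ 2 + M * N + 1 with hA
  have hA0 : 0 < A := by positivity
  refine ⟨N, min 1 (1 / (2 * C * A + 1)), hN0, by positivity, fun μ hμ0 hμ => ?_⟩
  have hμ1 : μ ≤ 1 := (hμ.trans_le (min_le_left _ _)).le
  have hμ2 : C * (A * μ) ≤ 1 / 2 := by
    have := (hμ.trans_le (min_le_right _ _)).le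
    rw [le_div_iff₀ (by positivity)] at this
    nlinarith
  have hL : (1 + a ^ 2) * (N * μ) ^ 2 + μ * M * (N * μ) + μ ≤ A * μ := by
    have : (1 + a ^ 2) * (N * μ) ^ 2 + μ * M * (N * μ) =
      ((1 + a ^ 2) * N ^ 2 + M * N) * μ * μ := by ring
    rw [this, hA]
    have : 0 ≤ ((1 + a ^ 2) * N ^ 2 + M * N) * μ := by positivity
    nlinarith
  have him {z : ℂ} {r : ℝ} (hz : ‖z‖ ≤ r) : |z.im / ω| ≤ r := by
    rw [abs_div, abs_of_pos hω0]
    exact (div_le_self (abs_nonneg _) hω1).trans ((Complex.abs_im_le_norm z).trans hz)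
  -- Complex coordinate `z = p + i ω φ`, with friction treated as part of the perturbation.
  obtain ⟨z, hz, hzp, hzr⟩ := exists_periodic_solution (ω := ω) (r := N * μ) (L := A * μ)
    (B := μ * M) Real.two_pi_pos (cexp_neg_two_pi_mul_ne_one ha)
    (H := fun t z => ((pendulumRemainder a μ f t (z.im / ω) - μ * z.re : ℝ) : ℂ))
    (by
      have := continuous_pendulumRemainder (a := a) (μ := μ) hf
      have h2 : Continuous fun q : ℝ × ℂ => (q.1, q.2.im / ω) := by fun_prop
      have h3 : Continuous fun q : ℝ × ℂ => μ * q.2.re := by fun_prop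
      exact Complex.continuous_ofReal.comp ((this.comp h2).sub h3))
    (fun t z => by simp only [pendulumRemainder, hper t]) (by positivity) (by positivity)
    (fun t z w hz hw => by
      rw [← Complex.ofReal_sub, Complex.norm_real, Real.norm_eq_abs, sub_sub_sub_comm]
      refine (abs_sub _ _).trans ?_
      have h1 := abs_pendulumRemainder_sub_le (a := a) hμ0.le (hM t) (him hz) (him hw)
      have h2 : |z.im / ω - w.im / ω| ≤ ‖z - w‖ := by
        rw [← sub_div, ← Complex.sub_im]
        exact him le_rfl
      have h3 : |μ * z.re - μ * w.re| ≤ μ * ‖z - w‖ := by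
        rw [← mul_sub, abs_mul, abs_of_pos hμ0, ← Complex.sub_re]
        exact mul_le_mul_of_nonneg_left (Complex.abs_re_le_norm _) hμ0.le
      calc _ ≤ ((1 + a ^ 2) * (N * μ) ^ 2 + μ * M * (N * μ)) * ‖z - w‖ + μ * ‖z - w‖ :=
            add_le_add (h1.trans (mul_le_mul_of_nonneg_left h2 (by positivity))) h3
        _ = ((1 + a ^ 2) * (N * μ) ^ 2 + μ * M * (N * μ) + μ) * ‖z - w‖ := by ring
        _ ≤ _ := mul_le_mul_of_nonneg_right hL (norm_nonneg _))
    (fun t => by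
      rw [Complex.norm_real]
      simp only [pendulumRemainder, Complex.zero_im, Complex.zero_re, zero_div, mul_zero,
        Real.sin_zero, Real.cos_zero, sub_zero, zero_add, mul_one, Real.norm_eq_abs, abs_mul,
        abs_of_pos hμ0]
      exact mul_le_mul_of_nonneg_left (hM t) hμ0.le)
    hμ2 (by rw [← hC, hN]; exact le_of_eq (by ring))
  refine ⟨fun t => ((z t).im / ω, (z t).re), fun t => ?_, fun t => by simp only [hzp t],
    fun t => him (hzr t)⟩
  rw [averagedPendulum_eq]
  have hre : HasDerivAt (fun t => (z t).re) _ t :=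
    Complex.reCLM.hasFDerivAt.comp_hasDerivAt t (hz t)
  have him' : HasDerivAt (fun t => (z t).im) _ t :=
    Complex.imCLM.hasFDerivAt.comp_hasDerivAt t (hz t)
  refine ((him'.div_const ω).prodMk hre).congr_deriv ?_
  simp only [Complex.imCLM_apply, Complex.reCLM_apply, Complex.add_im, Complex.add_re,
    Complex.mul_re, Complex.mul_im, Complex.I_re, Complex.I_im, Complex.ofReal_re,
    Complex.ofReal_im, Prod.mk.injEq]
  constructor
  · field_simp
    ring
  · rw [← hωsq]
    field_simp
    ring

/-! ### Asymptotic stability of the small solution. -/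

theorem norm_le_of_oscillatorLyapunov_le {k μ c : ℝ} (hk : 1 ≤ k) (hμ0 : 0 ≤ μ) (hμ1 : μ ≤ 1)
    {w : ℝ × ℝ} (hw : oscillatorLyapunov k μ w.1 w.2 ≤ c) : ‖w‖ ≤ Real.sqrt (2 * c) := by
  have := sq_add_sq_le_oscillatorLyapunov hk hμ0 hμ1 w.1 w.2
  rw [Prod.norm_def, max_le_iff]
  constructor <;> refine Real.abs_le_sqrt ?_ <;> nlinarith [sq_nonneg w.1, sq_nonneg w.2]

/-- The difference `y - x` obeys the damped oscillator with `ρ` a difference of remainders. While it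
stays within `μ` in position, both positions are at most `(N + 1) μ`, so the Lipschitz constant of
order `μ²` is at most `μ / 8`. -/
theorem oscillatorLyapunov_sub_le_exp {a μ M N η t₀ T : ℝ} {f : ℝ → ℝ} {x y : ℝ → ℝ × ℝ}
    (hM : ∀ t, |f t| ≤ M) (hμ0 : 0 < μ) (hμ1 : μ ≤ 1)
    (hμ : ((1 + a ^ 2) * (N + 1) ^ 2 + M * (N + 1)) * μ ≤ 1 / 8)
    (hx : IsIntegralCurve x (averagedPendulum a μ (fun t => μ * f t)))
    (hxN : ∀ t, |(x t).1| ≤ N * μ)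
    (hy : IsIntegralCurveOn y (averagedPendulum a μ (fun t => μ * f t)) (Icc t₀ T))
    (hη0 : 0 < η) (hη : η ≤ μ ^ 2 / 2)
    (h0 : oscillatorLyapunov (1 + a ^ 2 / 2) μ (y t₀ - x t₀).1 (y t₀ - x t₀).2 ≤ η) :
    ∀ t ∈ Icc t₀ T, oscillatorLyapunov (1 + a ^ 2 / 2) μ (y t - x t).1 (y t - x t).2 ≤
      η * Real.exp (-(μ / 4) * (t - t₀)) := by
  have hd (t : ℝ) (ht : t ∈ Icc t₀ T) := (hy t ht).sub (hx t).hasDerivWithinAt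
  simp only [averagedPendulum_eq] at hd
  refine oscillatorLyapunov_le_exp (u := fun t => (y t - x t).1) (v := fun t => (y t - x t).2)
    (ρ := fun t => pendulumRemainder a μ f t (y t).1 - pendulumRemainder a μ f t (x t).1)
    (by linarith [sq_nonneg a]) hμ0 hμ1 (fun t ht => ?_) (fun t ht => ?_) (fun t ht hu => ?_)
    hη0 hη h0
  · exact (ContinuousLinearMap.fst ℝ ℝ ℝ).hasFDerivAt.comp_hasDerivWithinAt t (hd t ht)
  · refine ((ContinuousLinearMap.snd ℝ ℝ ℝ).hasFDerivAt.comp_hasDerivWithinAt t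
      (hd t ht)).congr_deriv ?_
    simp only [ContinuousLinearMap.coe_snd', Prod.snd_sub, Prod.fst_sub]
    ring
  · simp only [Prod.fst_sub] at hu ⊢
    have hx1 : |(x t).1| ≤ (N + 1) * μ := by linarith [hxN t]
    have hy1 : |(y t).1| ≤ (N + 1) * μ := by
      have := abs_sub_abs_le_abs_sub (y t).1 (x t).1
      linarith [hxN t]
    refine (abs_pendulumRemainder_sub_le hμ0.le (hM t) hy1 hx1).trans ?_
    refine mul_le_mul_of_nonneg_right ?_ (abs_nonneg _)
    calc _ = ((1 + a ^ 2) * (N + 1) ^ 2 + M * (N + 1)) * μ * μ := by ring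
      _ ≤ 1 / 8 * μ := mul_le_mul_of_nonneg_right hμ hμ0.le
      _ = μ / 8 := by ring

/-- A periodic solution of size `O(μ)` changes the linearization at the equilibrium by `O(μ²)`,
which is dominated by the friction. -/
theorem isAsymptoticallyStable_of_small {a μ M N : ℝ} {f : ℝ → ℝ} {x : ℝ → ℝ × ℝ}
    (hM : ∀ t, |f t| ≤ M) (hμ0 : 0 < μ) (hμ1 : μ ≤ 1)
    (hμ : ((1 + a ^ 2) * (N + 1) ^ 2 + M * (N + 1)) * μ ≤ 1 / 8)
    (hx : IsIntegralCurve x (averagedPendulum a μ (fun t => μ * f t)))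
    (hxN : ∀ t, |(x t).1| ≤ N * μ) :
    IsAsymptoticallyStable (averagedPendulum a μ (fun t => μ * f t)) x := by
  have hk : 1 ≤ 1 + a ^ 2 / 2 := by linarith [sq_nonneg a]
  have hk0 : 0 < 1 + a ^ 2 / 2 + 2 := by linarith
  have hinit {η : ℝ} (hη : 0 < η) {w : ℝ × ℝ} (hw : ‖w‖ < Real.sqrt (η / (1 + a ^ 2 / 2 + 2))) :
      oscillatorLyapunov (1 + a ^ 2 / 2) μ w.1 w.2 ≤ η := by
    have := oscillatorLyapunov_lt hk hμ0.le hμ1 ((norm_fst_le w).trans_lt hw)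
      ((norm_snd_le w).trans_lt hw)
    rw [Real.sq_sqrt (by positivity), mul_div_cancel₀ _ hk0.ne'] at this
    exact this.le
  constructor
  · intro t₀ ε hε
    -- The first bound is the range of the decay estimate; the second gives `√(2η) < ε`.
    set η := min (μ ^ 2 / 2) (ε ^ 2 / 4)
    have hη : 0 < η := by positivity
    refine ⟨Real.sqrt (η / (1 + a ^ 2 / 2 + 2)), by positivity, fun T y hy hy0 t ht => ?_⟩
    have h1 := oscillatorLyapunov_sub_le_exp hM hμ0 hμ1 hμ hx hxN hy hη (min_le_left _ _)
      (hinit hη hy0) t ht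
    have h2 : η * Real.exp (-(μ / 4) * (t - t₀)) ≤ η := by
      refine mul_le_of_le_one_right hη.le (Real.exp_le_one_iff.2 ?_)
      nlinarith [ht.1]
    refine (norm_le_of_oscillatorLyapunov_le hk hμ0.le hμ1 (h1.trans h2)).trans_lt ?_
    rw [Real.sqrt_lt' hε]
    have : η ≤ ε ^ 2 / 4 := min_le_right _ _
    nlinarith
  · intro t₀
    have hη : 0 < μ ^ 2 / 2 := by positivity
    refine ⟨Real.sqrt (μ ^ 2 / 2 / (1 + a ^ 2 / 2 + 2)), by positivity, fun y hy hy0 => ?_⟩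
    have hbound : ∀ᶠ t in atTop,
        ‖y t - x t‖ ≤ Real.sqrt (2 * (μ ^ 2 / 2 * Real.exp (-(μ / 4) * (t - t₀)))) := by
      filter_upwards [eventually_ge_atTop t₀] with t ht
      exact norm_le_of_oscillatorLyapunov_le hk hμ0.le hμ1
        (oscillatorLyapunov_sub_le_exp hM hμ0 hμ1 hμ hx hxN
          (hy.mono (Icc_subset_Ici_self : Icc t₀ t ⊆ Ici t₀)) hη le_rfl (hinit hη hy0) t
          (right_mem_Icc.2 ht))
    refine squeeze_zero' (Eventually.of_forall fun t => norm_nonneg _) hbound ?_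
    have h1 : Tendsto (fun t : ℝ => -(μ / 4) * (t - t₀)) atTop atBot :=
      (tendsto_atTop_add_const_right atTop (-t₀) tendsto_id).const_mul_atTop_of_neg
        (by linarith)
    have h2 := (((Real.tendsto_exp_atBot.comp h1).const_mul (μ ^ 2 / 2)).const_mul 2).sqrt
    simpa using h2

theorem proposition2 (a : ℝ) (ha : ∀ n : ℤ, Real.sqrt (1 + a ^ 2 / 2) ≠ (n : ℝ))
    (f : ℝ → ℝ) (hf : AnalyticOnNhd ℝ f Set.univ) (hper : Function.Periodic f (2 * Real.pi)) :
    ∃ μ₀ : ℝ, 0 < μ₀ ∧ ∀ μ : ℝ, 0 < μ → μ < μ₀ →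
      ∃ x : ℝ → ℝ × ℝ,
        IsIntegralCurve x (averagedPendulum a μ (fun t => μ * f t)) ∧
        Function.Periodic x (2 * Real.pi) ∧
        IsAsymptoticallyStable (averagedPendulum a μ (fun t => μ * f t)) x := by
  have hfc : Continuous f := continuousOn_univ.1 hf.continuousOn
  obtain ⟨M, hM⟩ := (hper.isBounded_of_continuous Real.two_pi_pos.ne' hfc).exists_norm_le
  have hM' (t : ℝ) : |f t| ≤ M := hM _ (mem_range_self t)
  have hM0 : 0 ≤ M := (abs_nonneg _).trans (hM' 0)
  obtain ⟨N, μ₁, hN, hμ₁, hsol⟩ := exists_small_periodic_solution ha hfc hper hM'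
  have hD : 0 < 8 * ((1 + a ^ 2) * (N + 1) ^ 2 + M * (N + 1)) := by positivity
  refine ⟨min μ₁ (min 1 (1 / (8 * ((1 + a ^ 2) * (N + 1) ^ 2 + M * (N + 1))))), by positivity,
    fun μ hμ0 hμ => ?_⟩
  obtain ⟨h1, h2, h3⟩ : μ < μ₁ ∧ μ < 1 ∧ _ := by simpa only [lt_min_iff] using hμ
  obtain ⟨x, hx, hxp, hxN⟩ := hsol μ hμ0 h1
  refine ⟨x, hx, hxp, isAsymptoticallyStable_of_small hM' hμ0 h2.le ?_ hx hxN⟩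
  rw [lt_div_iff₀ hD] at h3
  linarith
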